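/- All graphs are finite, simple and undirected. A $d$-regular graph on $n$ vertices is called amply regular with parameters $(n,d,\alpha,\beta)$ if any two adjacent vertices have exactly $\alpha$ common neighbors and any two vertices at distance $2$ have exactly $\beta$ common neighbors. Let $G$ be a connected amply regular graph with parameters $(n,d,\alpha,\beta)$, $n\ge 2$, and let $\sigma_1\le\sigma_2\le\cdots\le\sigma_{n-1}\le\sigma_n$ be the eigenvalues of its adjacency matrix, counted with multiplicity. Then $\sigma_n=d$, and (i) if $1\ne\beta\ge\alpha$, then $\sigma_{n-1}\le d-2$; (ii) if $\beta>\alpha\ge 1$, then $\sigma_{n-1}\le d-3$. Both bounds are sharp. For $p\ge1$ and $q\ge 2$ let $H(p,q)$ be the Hamming graph, i.e. the Cartesian product of $p$ copies of the complete graph $K_q$. For every $p\ge 1$, the graph $H(p,2)$ is connected and amply regular with parameters $(2^p,p,0,2)$, and equality holds for it in (i), i.e. $\sigma_{n-1}=p-2$; and the graph $H(p,3)$ is connected and amply regular with parameters $(3^p,2p,1,2)$, and equality holds for it in (ii), i.e. $\sigma_{n-1}=2p-3$. -/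

import Mathlib

namespace AmplyRegular

/-- A finite simple graph is amply regular with parameters `(n, d, α, β)` if it has `n` vertices,
is `d`-regular, any two adjacent vertices have exactly `α` common neighbors, and any two vertices
at distance `2` have exactly `β` common neighbors. -/
structure IsAmplyRegular {V : Type*} [Fintype V] [DecidableEq V] (G : SimpleGraph V)
    [DecidableRel G.Adj] (n d α β : ℕ) : Prop where
  card : Fintype.card V = n
  regular : G.IsRegularOfDegree d
  of_adj : ∀ v w, G.Adj v w → Fintype.card (G.commonNeighbors v w) = α
  of_dist_two : ∀ v w, G.dist v w = 2 → Fintype.card (G.commonNeighbors v w) = β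

theorem isHermitian_adjMatrix {V : Type*} [Fintype V] [DecidableEq V] (G : SimpleGraph V)
    [DecidableRel G.Adj] : (G.adjMatrix ℝ).IsHermitian := by
  rw [Matrix.IsHermitian, Matrix.conjTranspose_eq_transpose_of_trivial]
  exact G.isSymm_adjMatrix

/-- The eigenvalues of the adjacency matrix of a graph on `n` vertices, listed with multiplicity
in increasing order: with indices starting at `0`, the entry `i` is the eigenvalue `σ_{i+1}`.
(`eigenvalues₀` lists them in decreasing order.) -/
noncomputable def adjEigenvalue {V : Type*} [Fintype V] [DecidableEq V] (G : SimpleGraph V)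
    [DecidableRel G.Adj] {n : ℕ} (hn : Fintype.card V = n) (i : Fin n) : ℝ :=
  (isHermitian_adjMatrix G).eigenvalues₀ (Fin.cast hn.symm i.rev)

/-- The Hamming graph `H(p, q)`: the Cartesian product of `p` copies of the complete graph `K_q`.
Two vertices are adjacent if they are adjacent in one factor and agree in all the others. -/
def hammingGraph (p q : ℕ) : SimpleGraph (Fin p → Fin q) where
  Adj x y := ∃ i, (⊤ : SimpleGraph (Fin q)).Adj (x i) (y i) ∧ ∀ j, j ≠ i → x j = y j
  symm := ⟨fun _ _ ⟨i, h, h'⟩ => ⟨i, h.symm, fun j hj => (h' j hj).symm⟩⟩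
  loopless := ⟨fun _ ⟨_, h, _⟩ => h.ne rfl⟩

instance (p q : ℕ) : DecidableRel (hammingGraph p q).Adj := fun x y =>
  inferInstanceAs (Decidable
    (∃ i, (⊤ : SimpleGraph (Fin q)).Adj (x i) (y i) ∧ ∀ j, j ≠ i → x j = y j))

end AmplyRegular

/-!
The bounds come from comparing an eigenvector with itself across one edge. Let `f` be a nonconstant
function on the vertices of a connected graph with `A f = σ f`, and let `x y` be an edge on which
`f x - f y` is as large as possible, equal to `L > 0`. Write `S = N(x) \ {y}` and `T = N(y) \ {x}`.
Subtracting the eigenvector equations at `x` and `y` gives `∑_S f - ∑_T f = (σ + 1) L`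
(`exists_extremal_edge`), so `σ` is bounded as soon as `S` can be moved to `T` cheaply.

Amply regular graphs carry an explicit plan for this: move one unit of mass from `z ∈ S` to `w ∈ T`
for each edge `z w`, and keep `β - α` units in place at each `z ∈ S ∩ T`. Counting common neighbors
of `z` and `y` shows that every `z ∈ S` emits exactly `β - 1` units, both when `z` is adjacent to
`y` and when it is at distance `2` from it (`IsAmplyRegular.sum_transport`); by symmetry every
`w ∈ T` receives `β - 1` units. Each unit moved along an edge costs at most `L`, and the
`(β - α) α` units that stay cost nothing, whence
`(β - 1) (σ + 1) ≤ (β - 1) (d - 1) - (β - α) α` (`IsAmplyRegular.mul_eigenvalue_le`).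
For `β ≥ 2`, dropping the last term gives
`σ ≤ d - 2`, and `(β - α) α ≥ β - 1` for `1 ≤ α < β` gives `σ ≤ d - 3`.
Using a fractional plan avoids any appeal to a perfect matching.

Two orthogonal nonzero vectors cannot both be constant, so of the eigenvectors for the two largest
eigenvalues one is nonconstant, and the bound applies to the second largest
(`adjEigenvalue_second_le`). For the Hamming graph `H(p, q)`, a function of a single coordinate with
sum zero is an eigenvector with eigenvalue `p (q - 1) - q`, which attains the bounds for `q = 2, 3`.
-/

namespace AmplyRegular

open Finset Matrix

/-! ### Functions on the vertices of a graph -/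

section Graph

variable {V : Type*} {G : SimpleGraph V}

theorem dist_eq_two_iff {u v : V} :
    G.dist u v = 2 ↔ u ≠ v ∧ ¬ G.Adj u v ∧ (G.commonNeighbors u v).Nonempty := by
  rw [← SimpleGraph.edist_eq_two_iff, SimpleGraph.dist, ENat.toNat_eq_iff (by norm_num)]
  rfl

theorem apply_eq_of_reachable {γ : Type*} {f : V → γ} (hf : ∀ x y, G.Adj x y → f x = f y)
    {u v : V} (h : G.Reachable u v) : f u = f v := by
  obtain ⟨p⟩ := h
  induction p with
  | nil => rfl
  | cons h _ ih => exact (hf _ _ h).trans ih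

variable [Fintype V]

/-- A nonconstant function on a connected graph has a steepest edge, and its slope is positive. -/
theorem exists_adj_max_sub (hG : G.Connected) {f : V → ℝ} {u v : V} (huv : f u ≠ f v) :
    ∃ x y, G.Adj x y ∧ 0 < f x - f y ∧ ∀ z w, G.Adj z w → f z - f w ≤ f x - f y := by
  classical
  obtain ⟨a, b, hab, hne⟩ : ∃ a b, G.Adj a b ∧ f a ≠ f b := by
    by_contra! h
    exact huv (apply_eq_of_reachable h (hG.preconnected u v))
  obtain ⟨⟨x, y⟩, hxy, hmax⟩ := Finset.exists_max_image
    (univ.filter fun e : V × V => G.Adj e.1 e.2) (fun e => f e.1 - f e.2) ⟨(a, b), by simpa⟩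
  simp only [mem_filter, mem_univ, true_and, Prod.forall] at hxy hmax
  refine ⟨x, y, hxy, ?_, hmax⟩
  rcases lt_or_gt_of_ne hne with h | h
  · linarith [hmax b a hab.symm]
  · linarith [hmax a b hab]

variable [DecidableRel G.Adj]

theorem card_commonNeighbors_eq (v w : V) :
    Fintype.card (G.commonNeighbors v w) = #{z | G.Adj v z ∧ G.Adj w z} := by
  rw [← Set.toFinset_card]
  congr 1
  ext z
  simp [SimpleGraph.mem_commonNeighbors]

theorem adjMatrix_mulVec_eq_iff {f : V → ℝ} {σ : ℝ} :
    G.adjMatrix ℝ *ᵥ f = σ • f ↔ ∀ x, ∑ z ∈ G.neighborFinset x, f z = σ * f x := by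
  simp [funext_iff, SimpleGraph.adjMatrix_mulVec_apply]

theorem eigenvalue_le_of_regular {d : ℕ} (hG : G.IsRegularOfDegree d) {f : V → ℝ} (hf0 : f ≠ 0)
    {σ : ℝ} (hf : G.adjMatrix ℝ *ᵥ f = σ • f) : σ ≤ d := by
  obtain ⟨v, hv⟩ := Function.ne_iff.1 hf0
  obtain ⟨x, -, hx⟩ := Finset.exists_max_image univ (fun x => |f x|) ⟨v, mem_univ v⟩
  have hpos : 0 < |f x| := (abs_pos.2 hv).trans_le (hx v (mem_univ v))
  refine le_of_mul_le_mul_right ?_ hpos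
  calc σ * |f x| ≤ |σ * f x| := by
        rw [abs_mul]; exact mul_le_mul_of_nonneg_right (le_abs_self σ) hpos.le
    _ = |∑ z ∈ G.neighborFinset x, f z| := by rw [adjMatrix_mulVec_eq_iff.1 hf x]
    _ ≤ ∑ z ∈ G.neighborFinset x, |f z| := Finset.abs_sum_le_sum_abs _ _
    _ ≤ ∑ z ∈ G.neighborFinset x, |f x| := Finset.sum_le_sum fun z _ => hx z (mem_univ z)
    _ = d * |f x| := by
        rw [Finset.sum_const, nsmul_eq_mul, G.card_neighborFinset_eq_degree, hG x]

end Graph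

/-! ### The transport plan across an edge -/

section Transport

variable {V : Type*} [Fintype V] [DecidableEq V] {G : SimpleGraph V} [DecidableRel G.Adj]
  {n d α β : ℕ}

/-- The row sums of the transport plan. A vertex `z ≠ y` adjacent to `x` sends one unit along each
edge to `N(y) \ {x}`, and keeps `β - α` units if it is itself in `N(y)`. It shares with `y` either
`α` neighbors (if adjacent) or `β` (if at distance `2`, through `x`), one of which is `x`. -/
theorem IsAmplyRegular.sum_transport (hG : IsAmplyRegular G n d α β) {x y z : V}
    (hxy : G.Adj x y) (hz : z ∈ (G.neighborFinset x).erase y) :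
    ∑ w ∈ (G.neighborFinset y).erase x,
      ((if G.Adj z w then (1 : ℝ) else 0) + if z = w then (β - α : ℝ) else 0) = β - 1 := by
  obtain ⟨hzy, hxz⟩ : z ≠ y ∧ G.Adj x z := by simpa using hz
  have hset : ((G.neighborFinset y).erase x).filter (G.Adj z)
      = ({w | G.Adj z w ∧ G.Adj y w} : Finset V).erase x := by
    ext w
    simp only [mem_filter, mem_erase, SimpleGraph.mem_neighborFinset, mem_univ, true_and]
    tauto
  have hcard : #(((G.neighborFinset y).erase x).filter (G.Adj z)) + 1
      = Fintype.card (G.commonNeighbors z y) := by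
    rw [hset, card_commonNeighbors_eq]
    exact Finset.card_erase_add_one (by simp [hxz.symm, hxy.symm])
  have hcard' : (#(((G.neighborFinset y).erase x).filter (G.Adj z)) : ℝ)
      = (Fintype.card (G.commonNeighbors z y) : ℝ) - 1 := by
    rw [← hcard]; push_cast; ring
  rw [Finset.sum_add_distrib, Finset.sum_boole, Finset.sum_ite_eq, hcard']
  by_cases h : G.Adj z y
  · rw [hG.of_adj z y h, if_pos (by simp [h.symm, hxz.ne'])]
    ring
  · rw [hG.of_dist_two z y (dist_eq_two_iff.2 ⟨hzy, h, x, hxz.symm, hxy.symm⟩),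
      if_neg (by simp [G.adj_comm y z, h])]
    ring

theorem IsAmplyRegular.card_neighborFinset_erase (hG : IsAmplyRegular G n d α β) {x y : V}
    (hxy : G.Adj x y) : (#((G.neighborFinset x).erase y) : ℝ) = d - 1 := by
  have h := Finset.card_erase_add_one (show y ∈ G.neighborFinset x by simpa)
  rw [G.card_neighborFinset_eq_degree, hG.regular x] at h
  rw [← h]; push_cast; ring

theorem IsAmplyRegular.card_inter (hG : IsAmplyRegular G n d α β) {x y : V} (hxy : G.Adj x y) :
    #{z ∈ (G.neighborFinset x).erase y | z ∈ (G.neighborFinset y).erase x} = α := by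
  rw [← hG.of_adj x y hxy, card_commonNeighbors_eq]
  congr 1
  ext z
  simp only [mem_filter, mem_erase, SimpleGraph.mem_neighborFinset, mem_univ, true_and]
  constructor
  · tauto
  · rintro ⟨h, h'⟩
    exact ⟨⟨h'.ne', h⟩, h.ne', h'⟩

/-- The cost of the transport plan: of the `(β - 1) (d - 1)` units of mass, `(β - α) α` stay in place
and the others move along one edge. The column sums are row sums for the reversed edge. -/
theorem IsAmplyRegular.transport_le (hG : IsAmplyRegular G n d α β) {f : V → ℝ} {L : ℝ}
    (hL : ∀ z w, G.Adj z w → f z - f w ≤ L) {x y : V} (hxy : G.Adj x y) :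
    ((β : ℝ) - 1) * (∑ z ∈ (G.neighborFinset x).erase y, f z -
        ∑ w ∈ (G.neighborFinset y).erase x, f w)
      ≤ (((β : ℝ) - 1) * (d - 1) - (β - α) * α) * L := by
  set S := (G.neighborFinset x).erase y with hS
  set T := (G.neighborFinset y).erase x with hT
  let a : V → V → ℝ := fun z w => if G.Adj z w then 1 else 0
  let c : V → V → ℝ := fun z w => a z w + if z = w then (β - α : ℝ) else 0
  have hrow : ∀ z ∈ S, ∑ w ∈ T, c z w = β - 1 := fun z hz => hG.sum_transport hxy hz
  have hcol : ∀ w ∈ T, ∑ z ∈ S, c z w = β - 1 := fun w hw => by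
    simpa only [c, a, G.adj_comm w, eq_comm (a := w)] using hG.sum_transport hxy.symm hw
  have hmass : ∑ z ∈ S, ∑ w ∈ T, a z w = (β - 1) * (d - 1) - (β - α) * α := by
    have h1 : ∑ z ∈ S, ∑ w ∈ T, c z w = (d - 1) * (β - 1) := by
      rw [Finset.sum_congr rfl hrow, Finset.sum_const, nsmul_eq_mul, hS,
        hG.card_neighborFinset_erase hxy]
    have h2 : ∑ z ∈ S, ∑ w ∈ T, (if z = w then (β - α : ℝ) else 0) = α * (β - α) := by
      simp only [Finset.sum_ite_eq]
      rw [← Finset.sum_filter, Finset.sum_const, nsmul_eq_mul, hG.card_inter hxy]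
    simp only [c, Finset.sum_add_distrib] at h1
    linarith
  calc ((β : ℝ) - 1) * (∑ z ∈ S, f z - ∑ w ∈ T, f w)
      = ∑ z ∈ S, (β - 1) * f z - ∑ w ∈ T, (β - 1) * f w := by
        rw [mul_sub, Finset.mul_sum, Finset.mul_sum]
    _ = ∑ z ∈ S, ∑ w ∈ T, c z w * f z - ∑ w ∈ T, ∑ z ∈ S, c z w * f w := by
        congr 1 <;> refine Finset.sum_congr rfl fun v hv => ?_
        · rw [← Finset.sum_mul, hrow v hv]
        · rw [← Finset.sum_mul, hcol v hv]
    _ = ∑ z ∈ S, ∑ w ∈ T, c z w * (f z - f w) := by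
        rw [Finset.sum_comm (s := T)]
        simp only [← Finset.sum_sub_distrib, mul_sub]
    _ ≤ ∑ z ∈ S, ∑ w ∈ T, a z w * L := by
        refine Finset.sum_le_sum fun z _ => Finset.sum_le_sum fun w _ => ?_
        by_cases hzw : G.Adj z w
        · simpa [c, a, hzw, hzw.ne] using hL z w hzw
        -- Mass that stays in place contributes nothing.
        · rcases eq_or_ne z w with rfl | h <;> simp_all [c, a]
    _ = _ := by rw [← hmass, Finset.sum_mul]; simp only [Finset.sum_mul]

/-- The eigenvector equations at the two ends of a steepest edge, subtracted. -/
theorem exists_extremal_edge (hconn : G.Connected) {f : V → ℝ} {σ : ℝ}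
    (hf : G.adjMatrix ℝ *ᵥ f = σ • f) {u v : V} (huv : f u ≠ f v) :
    ∃ x y L, G.Adj x y ∧ 0 < L ∧ (∀ z w, G.Adj z w → f z - f w ≤ L) ∧
      ∑ z ∈ (G.neighborFinset x).erase y, f z - ∑ w ∈ (G.neighborFinset y).erase x, f w
        = (σ + 1) * L := by
  obtain ⟨x, y, hxy, hpos, hmax⟩ := exists_adj_max_sub hconn huv
  refine ⟨x, y, _, hxy, hpos, hmax, ?_⟩
  have hx := adjMatrix_mulVec_eq_iff.1 hf x
  have hy := adjMatrix_mulVec_eq_iff.1 hf y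
  rw [← Finset.sum_erase_add _ _ (show y ∈ G.neighborFinset x by simpa)] at hx
  rw [← Finset.sum_erase_add _ _ (show x ∈ G.neighborFinset y by simpa using hxy.symm)] at hy
  linarith

theorem IsAmplyRegular.mul_eigenvalue_le (hG : IsAmplyRegular G n d α β) (hconn : G.Connected)
    {f : V → ℝ} {σ : ℝ} (hf : G.adjMatrix ℝ *ᵥ f = σ • f) {u v : V} (huv : f u ≠ f v) :
    ((β : ℝ) - 1) * (σ + 1) ≤ (β - 1) * (d - 1) - (β - α) * α := by
  obtain ⟨x, y, L, hxy, hL, hmax, hsum⟩ := exists_extremal_edge hconn hf huv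
  have h := hG.transport_le hmax hxy
  rw [hsum, ← mul_assoc] at h
  exact le_of_mul_le_mul_right h hL

theorem IsAmplyRegular.eigenvalue_le_sub_two (hG : IsAmplyRegular G n d α β)
    (hconn : G.Connected) (hβ : 1 ≠ β) (hαβ : α ≤ β) {f : V → ℝ} {σ : ℝ}
    (hf : G.adjMatrix ℝ *ᵥ f = σ • f) {u v : V} (huv : f u ≠ f v) : σ ≤ d - 2 := by
  rcases Nat.eq_zero_or_pos β with rfl | hpos
  -- If `β = 0` then also `α = 0`, and the row sums of the transport plan, which are sums of
  -- nonnegative terms, would be `-1`: so there are no rows, and the graph is a single edge.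
  · obtain rfl : α = 0 := by omega
    obtain ⟨x, y, L, hxy, hL, -, hsum⟩ := exists_extremal_edge hconn hf huv
    have hempty : ∀ {x y : V}, G.Adj x y → (G.neighborFinset x).erase y = ∅ := by
      intro x y hxy
      refine Finset.eq_empty_of_forall_notMem fun z hz => ?_
      have h := hG.sum_transport hxy hz
      have h' : 0 ≤ ∑ w ∈ (G.neighborFinset y).erase x, ((if G.Adj z w then (1 : ℝ) else 0) +
          if z = w then (((0 : ℕ) : ℝ) - ((0 : ℕ) : ℝ)) else 0) :=
        Finset.sum_nonneg fun w _ => by split_ifs <;> norm_num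
      rw [h] at h'
      norm_num at h'
    have hd := hG.card_neighborFinset_erase hxy
    rw [hempty hxy, Finset.card_empty, Nat.cast_zero] at hd
    rw [hempty hxy, hempty hxy.symm, Finset.sum_empty, sub_zero, zero_eq_mul] at hsum
    rcases hsum with h | h <;> linarith
  · have hβ' : (0 : ℝ) < β - 1 := by
      have : (2 : ℝ) ≤ β := by exact_mod_cast (by omega : 2 ≤ β)
      linarith
    have h := hG.mul_eigenvalue_le hconn hf huv
    have h' : 0 ≤ ((β : ℝ) - α) * α :=
      mul_nonneg (sub_nonneg.2 (by exact_mod_cast hαβ)) (Nat.cast_nonneg α)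
    have := le_of_mul_le_mul_left (h.trans (sub_le_self _ h')) hβ'
    linarith

theorem IsAmplyRegular.eigenvalue_le_sub_three (hG : IsAmplyRegular G n d α β)
    (hconn : G.Connected) (hαβ : α < β) (hα : 1 ≤ α) {f : V → ℝ} {σ : ℝ}
    (hf : G.adjMatrix ℝ *ᵥ f = σ • f) {u v : V} (huv : f u ≠ f v) : σ ≤ d - 3 := by
  have hα' : (1 : ℝ) ≤ α := by exact_mod_cast hα
  have hαβ' : (α : ℝ) + 1 ≤ β := by exact_mod_cast hαβ
  have h := hG.mul_eigenvalue_le hconn hf huv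
  -- `(β - α) * α` is concave in `α` and equals `β - 1` at `α = 1` and at `α = β - 1`.
  have hconcave : (β : ℝ) - 1 ≤ (β - α) * α := by
    nlinarith [mul_nonneg (sub_nonneg.2 hα') (sub_nonneg.2 hαβ')]
  have : ((β : ℝ) - 1) * (σ + 1) ≤ (β - 1) * (d - 2) := by linarith
  linarith [le_of_mul_le_mul_left this (by linarith)]

end Transport

/-! ### The two largest adjacency eigenvalues -/

section Spectrum

/-- Two orthogonal nonzero vectors are not both constant. -/
theorem exists_ne_or_exists_ne {V : Type*} [Fintype V] {u v : EuclideanSpace ℝ V}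
    (hu : u ≠ 0) (hv : v ≠ 0) (huv : inner ℝ u v = 0) :
    (∃ x y, u x ≠ u y) ∨ ∃ x y, v x ≠ v y := by
  by_contra! h
  obtain ⟨hcu, hcv⟩ := h
  have hx : ∃ x, u x ≠ 0 := by
    by_contra! h'
    exact hu (by ext x; exact h' x)
  obtain ⟨x, hx⟩ := hx
  have hvx : v x ≠ 0 := fun h' => hv (by ext y; exact (hcv y x).trans h')
  have hsum : inner ℝ u v = ∑ _z : V, v x * u x := by
    rw [PiLp.inner_apply]
    refine Finset.sum_congr rfl fun z _ => ?_
    rw [hcu z x, hcv z x]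
    simp
  have : Nonempty V := ⟨x⟩
  rw [hsum, Finset.sum_const, nsmul_eq_mul] at huv
  simp [hx, hvx] at huv

variable {V : Type*} [Fintype V] [DecidableEq V] {G : SimpleGraph V} [DecidableRel G.Adj]
  {n d : ℕ}

/-- An orthonormal family of eigenvectors in the order of `adjEigenvalue`. -/
theorem exists_eigenvector_adjEigenvalue (hn : Fintype.card V = n) :
    ∃ u : Fin n → EuclideanSpace ℝ V, Orthonormal ℝ u ∧
      ∀ i, G.adjMatrix ℝ *ᵥ (u i) = adjEigenvalue G hn i • ⇑(u i) := by
  have hA := isHermitian_adjMatrix G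
  let e : Fin (Fintype.card V) ≃ V := Fintype.equivOfCardEq (Fintype.card_fin _)
  let r : Fin n → V := fun i => e (Fin.cast hn.symm i.rev)
  refine ⟨fun i => hA.eigenvectorBasis (r i), hA.eigenvectorBasis.orthonormal.comp r ?_, ?_⟩
  · exact e.injective.comp ((Fin.cast_injective _).comp Fin.rev_injective)
  · intro i
    rw [hA.mulVec_eigenvectorBasis]
    simp [adjEigenvalue, Matrix.IsHermitian.eigenvalues, r, e]

theorem adjEigenvalue_monotone (hn : Fintype.card V = n) : Monotone (adjEigenvalue G hn) :=
  fun _ _ h => (isHermitian_adjMatrix G).eigenvalues₀_antitone (Fin.rev_le_rev.2 h)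

theorem exists_adjEigenvalue_eq (hn : Fintype.card V = n) {f : V → ℝ} (hf0 : f ≠ 0) {σ : ℝ}
    (hf : G.adjMatrix ℝ *ᵥ f = σ • f) : ∃ i, adjEigenvalue G hn i = σ := by
  have hA := isHermitian_adjMatrix G
  have hσ : σ ∈ spectrum ℝ (G.adjMatrix ℝ) := by
    rw [← Matrix.spectrum_toLin']
    refine Module.End.HasEigenvalue.mem_spectrum
      (Module.End.hasEigenvalue_of_hasEigenvector (x := f) ⟨?_, hf0⟩)
    simpa [Module.End.mem_eigenspace_iff] using hf
  rw [hA.spectrum_real_eq_range_eigenvalues] at hσ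
  obtain ⟨v, hv⟩ := hσ
  subst hn
  refine ⟨((Fintype.equivOfCardEq (Fintype.card_fin _)).symm v).rev, ?_⟩
  rw [← hv]
  simp [adjEigenvalue, Matrix.IsHermitian.eigenvalues]

theorem adjEigenvalue_le (hn : Fintype.card V = n) (hG : G.IsRegularOfDegree d) (i : Fin n) :
    adjEigenvalue G hn i ≤ d := by
  obtain ⟨u, hu, hAu⟩ := exists_eigenvector_adjEigenvalue (G := G) hn
  refine eigenvalue_le_of_regular hG (fun h => hu.ne_zero i ?_) (hAu i)
  ext x
  exact congrFun h x

theorem adjEigenvalue_last (hn : Fintype.card V = n) (hG : G.IsRegularOfDegree d) (h0 : 0 < n) :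
    adjEigenvalue G hn ⟨n - 1, by omega⟩ = d := by
  have : Nonempty V := Fintype.card_pos_iff.1 (hn ▸ h0)
  obtain ⟨i, hi⟩ := exists_adjEigenvalue_eq (G := G) hn (f := fun _ => 1) (σ := d)
    (Function.ne_iff.2 ⟨Classical.arbitrary V, one_ne_zero⟩)
    (adjMatrix_mulVec_eq_iff.2 fun x => by simp [hG x])
  refine le_antisymm (adjEigenvalue_le hn hG _) (hi ▸ adjEigenvalue_monotone hn ?_)
  exact Fin.mk_le_mk.2 (by omega : (i : ℕ) ≤ n - 1)

/-- A bound for all eigenvalues with a nonconstant eigenvector bounds the second largest eigenvalue: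
if the eigenvector chosen for it is constant, then the one for the largest eigenvalue is not. -/
theorem adjEigenvalue_second_le (hn : Fintype.card V = n) (h2 : 2 ≤ n)
    {c : ℝ} (hc : ∀ (f : V → ℝ) (σ : ℝ), G.adjMatrix ℝ *ᵥ f = σ • f →
      (∃ x y, f x ≠ f y) → σ ≤ c) : adjEigenvalue G hn ⟨n - 2, by omega⟩ ≤ c := by
  obtain ⟨u, hu, hAu⟩ := exists_eigenvector_adjEigenvalue (G := G) hn
  have hij : (⟨n - 2, by omega⟩ : Fin n) ≠ ⟨n - 1, by omega⟩ := by
    simp only [ne_eq, Fin.mk.injEq]; omega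
  rcases exists_ne_or_exists_ne (hu.ne_zero _) (hu.ne_zero _) (hu.2 hij) with h | h
  · exact hc _ _ (hAu _) h
  · refine (adjEigenvalue_monotone hn (Fin.mk_le_mk.2 (by omega))).trans (hc _ _ (hAu _) h)

/-- An eigenvalue of a `d`-regular graph other than the largest one, `d`, is at most the second
largest. -/
theorem le_adjEigenvalue_second (hn : Fintype.card V = n) (h2 : 2 ≤ n)
    (hG : G.IsRegularOfDegree d) {f : V → ℝ} (hf0 : f ≠ 0) {σ : ℝ}
    (hf : G.adjMatrix ℝ *ᵥ f = σ • f) (hσ : σ < d) :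
    σ ≤ adjEigenvalue G hn ⟨n - 2, by omega⟩ := by
  obtain ⟨i, rfl⟩ := exists_adjEigenvalue_eq hn hf0 hf
  have hi : (i : ℕ) ≠ n - 1 := by
    intro h
    rw [← adjEigenvalue_last hn hG (by omega)] at hσ
    exact hσ.ne (congrArg _ (Fin.ext h))
  refine adjEigenvalue_monotone hn (Fin.mk_le_mk.2 (?_ : (i : ℕ) ≤ n - 2))
  omega

end Spectrum

/-! ### Hamming graphs -/

section Hamming

open Function

variable {p q : ℕ}

theorem hammingGraph_adj_iff {x y : Fin p → Fin q} :
    (hammingGraph p q).Adj x y ↔ ∃ i a, a ≠ x i ∧ y = update x i a := by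
  constructor
  · rintro ⟨i, h, h'⟩
    refine ⟨i, y i, h.ne', ?_⟩
    exact (eq_update_iff.2 ⟨rfl, fun j hj => (h' j hj).symm⟩)
  · rintro ⟨i, a, ha, rfl⟩
    exact ⟨i, by simpa using ha.symm, fun j hj => by simp [hj]⟩

/-- Adjacent vertices of a Hamming graph differ in at most one coordinate. -/
theorem hammingGraph_adj_apply_eq {x y : Fin p → Fin q} (h : (hammingGraph p q).Adj x y)
    {i j : Fin p} (hi : x i ≠ y i) (hj : j ≠ i) : x j = y j := by
  obtain ⟨k, -, hk⟩ := h
  obtain rfl : i = k := by_contra fun hik => hi (hk i hik)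
  exact hk j hj

/-- The coordinates of `x` can be changed into those of `y` one at a time. -/
theorem hammingGraph_connected (hq : 1 ≤ q) : (hammingGraph p q).Connected := by
  have : NeZero q := ⟨by omega⟩
  refine { preconnected := fun x y => ?_, nonempty := ⟨fun _ => 0⟩ }
  have key : ∀ s : Finset (Fin p), (hammingGraph p q).Reachable x (s.piecewise y x) := by
    intro s
    induction s using Finset.induction_on with
    | empty => simp
    | insert i s _ ih =>
      rw [Finset.piecewise_insert]
      refine ih.trans ?_
      by_cases h : y i = s.piecewise y x i
      · rw [h, update_eq_self]
      · exact (hammingGraph_adj_iff.2 ⟨i, _, h, rfl⟩).reachable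
  simpa using key univ

theorem sum_neighborFinset_hammingGraph {M : Type*} [AddCommMonoid M] (F : (Fin p → Fin q) → M)
    (x : Fin p → Fin q) : ∑ y ∈ (hammingGraph p q).neighborFinset x, F y
      = ∑ i, ∑ a ∈ univ.erase (x i), F (update x i a) := by
  rw [Finset.sum_sigma']
  symm
  refine Finset.sum_bij (fun e _ => update x e.1 e.2) ?_ ?_ ?_ fun _ _ => rfl
  · rintro ⟨i, a⟩ h
    simp only [mem_sigma, mem_univ, mem_erase, true_and, and_true] at h
    simpa using hammingGraph_adj_iff.2 ⟨i, a, h, rfl⟩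
  · rintro ⟨i, a⟩ h ⟨j, b⟩ _ hij
    simp only [mem_sigma, mem_univ, mem_erase, true_and, and_true] at h hij
    have hi := congrFun hij i
    rw [update_self] at hi
    obtain rfl : i = j := by
      by_contra hne
      rw [update_of_ne hne] at hi
      exact h hi
    rw [update_self] at hi
    rw [hi]
  · intro y hy
    obtain ⟨i, a, ha, rfl⟩ := hammingGraph_adj_iff.1 ((SimpleGraph.mem_neighborFinset _ _ _).1 hy)
    exact ⟨⟨i, a⟩, by simpa using ha, rfl⟩

theorem hammingGraph_isRegularOfDegree :
    (hammingGraph p q).IsRegularOfDegree (p * (q - 1)) := by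
  intro x
  rw [← SimpleGraph.card_neighborFinset_eq_degree, Finset.card_eq_sum_ones,
    sum_neighborFinset_hammingGraph]
  simp

/-- The common neighbors of two vertices that differ in coordinate `i` only are obtained by giving
coordinate `i` a third value. -/
theorem card_commonNeighbors_hammingGraph_of_adj {x y : Fin p → Fin q}
    (h : (hammingGraph p q).Adj x y) :
    Fintype.card ((hammingGraph p q).commonNeighbors x y) = q - 2 := by
  obtain ⟨i, a, ha, rfl⟩ := hammingGraph_adj_iff.1 h
  have hset : ({z | (hammingGraph p q).Adj x z ∧ (hammingGraph p q).Adj (update x i a) z} :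
      Finset (Fin p → Fin q)) = (({x i, a} : Finset (Fin q))ᶜ).image (update x i) := by
    ext z
    simp only [mem_filter, mem_univ, true_and, mem_image, mem_compl, mem_insert, mem_singleton,
      not_or]
    constructor
    · rintro ⟨h1, h2⟩
      obtain ⟨j, b, hb, rfl⟩ := hammingGraph_adj_iff.1 h1
      obtain rfl : j = i := by
        by_contra hij
        have := hammingGraph_adj_apply_eq h2 (i := j) (j := i) (by simp [hij, hb.symm])
          (Ne.symm hij)
        rw [update_self, update_of_ne (Ne.symm hij)] at this
        exact ha this
      exact ⟨b, ⟨hb, fun hba => h2.ne (by rw [hba])⟩, rfl⟩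
    · rintro ⟨b, ⟨hb, hba⟩, rfl⟩
      exact ⟨hammingGraph_adj_iff.2 ⟨i, b, hb, rfl⟩,
        hammingGraph_adj_iff.2 ⟨i, b, by simpa using hba, by simp⟩⟩
  rw [card_commonNeighbors_eq, hset, Finset.card_image_of_injective _ (update_injective x i),
    Finset.card_compl, Finset.card_pair ha.symm, Fintype.card_fin]

/-- Vertices at distance two differ in exactly two coordinates `i` and `j`, and their common
neighbors are obtained by changing one of the two first. -/
theorem card_commonNeighbors_hammingGraph_of_dist_eq_two {x y : Fin p → Fin q}
    (h : (hammingGraph p q).dist x y = 2) :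
    Fintype.card ((hammingGraph p q).commonNeighbors x y) = 2 := by
  obtain ⟨hne, hadj, w, hxw, hyw⟩ := dist_eq_two_iff.1 h
  obtain ⟨i, a, ha, rfl⟩ := hammingGraph_adj_iff.1 hxw
  obtain ⟨j, b, hb, rfl⟩ := hammingGraph_adj_iff.1 hyw.symm
  have hij : i ≠ j := by
    rintro rfl
    rw [update_idem] at hne hadj
    refine hadj (hammingGraph_adj_iff.2 ⟨i, b, ?_, rfl⟩)
    rintro rfl
    simp at hne
  rw [update_of_ne hij.symm] at hb
  have hset : ({z | (hammingGraph p q).Adj x z ∧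
      (hammingGraph p q).Adj (update (update x i a) j b) z} : Finset (Fin p → Fin q))
        = {update x i a, update x j b} := by
    ext z
    simp only [mem_filter, mem_univ, true_and, mem_insert, mem_singleton]
    constructor
    · rintro ⟨h1, h2⟩
      obtain ⟨k, c, hc, rfl⟩ := hammingGraph_adj_iff.1 h1
      by_cases hki : k = i
      · subst hki
        have := hammingGraph_adj_apply_eq h2 (i := j) (j := k) (by simp [hij.symm, hb]) hij
        simp only [update_of_ne hij, update_self] at this
        exact Or.inl (by rw [this])
      · have hi := hammingGraph_adj_apply_eq h2 (i := i) (j := j)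
          (by simp [hij, Ne.symm hki, ha]) hij.symm
        have hkj : k = j := by
          by_contra hkj
          rw [update_self, update_of_ne (Ne.symm hkj)] at hi
          exact hb hi
        subst hkj
        simp only [update_self] at hi
        exact Or.inr (by rw [hi])
    · rintro (rfl | rfl)
      · exact ⟨hxw, hyw⟩
      · refine ⟨hammingGraph_adj_iff.2 ⟨j, b, hb, rfl⟩, ?_⟩
        rw [update_comm hij]
        exact (hammingGraph_adj_iff.2 ⟨i, a, by rwa [update_of_ne hij], rfl⟩).symm
  rw [card_commonNeighbors_eq, hset, Finset.card_pair]
  intro heq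
  have := congrFun heq i
  rw [update_self, update_of_ne hij] at this
  exact ha this

theorem isAmplyRegular_hammingGraph (p q : ℕ) :
    IsAmplyRegular (hammingGraph p q) (q ^ p) (p * (q - 1)) (q - 2) 2 where
  card := by simp
  regular := hammingGraph_isRegularOfDegree
  of_adj _ _ h := card_commonNeighbors_hammingGraph_of_adj h
  of_dist_two _ _ h := card_commonNeighbors_hammingGraph_of_dist_eq_two h

/-- Among the neighbors of `x`, those that change coordinate `k` contribute `-g (x k)`, and the
other `(p - 1) (q - 1)` contribute `g (x k)` each. -/
theorem hammingGraph_mulVec_eq (k : Fin p) (hq : 1 ≤ q) {g : Fin q → ℝ} (hg : ∑ a, g a = 0) :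
    (hammingGraph p q).adjMatrix ℝ *ᵥ (fun x => g (x k))
      = ((p * (q - 1) : ℕ) - q : ℝ) • fun x => g (x k) := by
  refine adjMatrix_mulVec_eq_iff.2 fun x => ?_
  have hterm : ∀ i, ∑ a ∈ univ.erase (x i), g (update x i a k)
      = ((q : ℝ) - 1) * g (x k) - if i = k then q * g (x k) else 0 := by
    intro i
    by_cases h : i = k
    · subst h
      have := Finset.sum_erase_add univ g (mem_univ (x i))
      simp only [update_self, if_true]
      linarith
    · simp only [update_of_ne (Ne.symm h), if_neg h, Finset.sum_const, nsmul_eq_mul, sub_zero]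
      rw [Finset.card_erase_of_mem (mem_univ _), Finset.card_univ, Fintype.card_fin,
        Nat.cast_sub hq, Nat.cast_one]
  rw [sum_neighborFinset_hammingGraph, Finset.sum_congr rfl fun i _ => hterm i,
    Finset.sum_sub_distrib, Finset.sum_ite_eq']
  simp only [Finset.sum_const, card_univ, Fintype.card_fin, nsmul_eq_mul, mem_univ, if_true]
  rw [Nat.cast_mul, Nat.cast_sub hq, Nat.cast_one]
  ring

theorem le_adjEigenvalue_second_hammingGraph (hp : 1 ≤ p) (hq : 2 ≤ q)
    (hn : Fintype.card (Fin p → Fin q) = q ^ p) (h2 : 2 ≤ q ^ p) :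
    ((p * (q - 1) : ℕ) - q : ℝ)
      ≤ adjEigenvalue (hammingGraph p q) hn ⟨q ^ p - 2, by omega⟩ := by
  let g : Fin q → ℝ := Pi.single ⟨0, by omega⟩ 1 - Pi.single ⟨1, by omega⟩ 1
  have hg : ∑ a, g a = 0 := by simp [g, Finset.sum_sub_distrib]
  refine le_adjEigenvalue_second hn h2 hammingGraph_isRegularOfDegree ?_
    (hammingGraph_mulVec_eq ⟨0, by omega⟩ (by omega) hg) ?_
  · refine Function.ne_iff.2 ⟨fun _ => ⟨0, by omega⟩, ?_⟩
    simp [g]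
  · have : (0 : ℝ) < q := by exact_mod_cast (by omega : 0 < q)
    linarith

end Hamming

end AmplyRegular

theorem corollary1p5 :
    -- the two eigenvalue bounds (`σ_n` has index `n - 1` and `σ_{n-1}` has index `n - 2`)
    (∀ {V : Type*} [Fintype V] [DecidableEq V] (G : SimpleGraph V) [DecidableRel G.Adj]
        (n d α β : ℕ) (hn : 2 ≤ n) (_ : G.Connected)
        (hG : AmplyRegular.IsAmplyRegular G n d α β),
      AmplyRegular.adjEigenvalue G hG.card ⟨n - 1, by omega⟩ = d ∧
      (1 ≠ β → α ≤ β →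
        AmplyRegular.adjEigenvalue G hG.card ⟨n - 2, by omega⟩ ≤ (d : ℝ) - 2) ∧
      (α < β → 1 ≤ α →
        AmplyRegular.adjEigenvalue G hG.card ⟨n - 2, by omega⟩ ≤ (d : ℝ) - 3)) ∧
    -- sharpness of the first bound: `H(p, 2)`
    (∀ p : ℕ, 1 ≤ p →
      (AmplyRegular.hammingGraph p 2).Connected ∧
      ∃ hG : AmplyRegular.IsAmplyRegular (AmplyRegular.hammingGraph p 2) (2 ^ p) p 0 2,
        AmplyRegular.adjEigenvalue (AmplyRegular.hammingGraph p 2) hG.card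
          ⟨2 ^ p - 2, Nat.sub_lt (by positivity) (by norm_num)⟩ = (p : ℝ) - 2) ∧
    -- sharpness of the second bound: `H(p, 3)`
    (∀ p : ℕ, 1 ≤ p →
      (AmplyRegular.hammingGraph p 3).Connected ∧
      ∃ hG : AmplyRegular.IsAmplyRegular (AmplyRegular.hammingGraph p 3) (3 ^ p) (2 * p) 1 2,
        AmplyRegular.adjEigenvalue (AmplyRegular.hammingGraph p 3) hG.card
          ⟨3 ^ p - 2, Nat.sub_lt (by positivity) (by norm_num)⟩ = ((2 * p : ℕ) : ℝ) - 3) := by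
  refine ⟨?_, ?_, ?_⟩
  · intro V _ _ G _ n d α β hn hconn hG
    refine ⟨AmplyRegular.adjEigenvalue_last hG.card hG.regular (by omega), fun hβ hαβ => ?_,
      fun hαβ hα => ?_⟩
    · exact AmplyRegular.adjEigenvalue_second_le hG.card hn fun f σ hf ⟨_, _, h⟩ =>
        hG.eigenvalue_le_sub_two hconn hβ hαβ hf h
    · exact AmplyRegular.adjEigenvalue_second_le hG.card hn fun f σ hf ⟨_, _, h⟩ =>
        hG.eigenvalue_le_sub_three hconn hαβ hα hf h
  · intro p hp
    have hconn := AmplyRegular.hammingGraph_connected (p := p) (q := 2) (by norm_num)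
    have hG : AmplyRegular.IsAmplyRegular (AmplyRegular.hammingGraph p 2) (2 ^ p) p 0 2 := by
      simpa using AmplyRegular.isAmplyRegular_hammingGraph p 2
    have h2 : 2 ≤ 2 ^ p := Nat.le_self_pow (by omega) 2
    refine ⟨hconn, hG, le_antisymm ?_ ?_⟩
    · exact AmplyRegular.adjEigenvalue_second_le hG.card h2 fun f σ hf ⟨_, _, h⟩ =>
        hG.eigenvalue_le_sub_two hconn (by norm_num) (by norm_num) hf h
    · simpa using AmplyRegular.le_adjEigenvalue_second_hammingGraph hp le_rfl hG.card h2
  · intro p hp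
    have hconn := AmplyRegular.hammingGraph_connected (p := p) (q := 3) (by norm_num)
    have hG : AmplyRegular.IsAmplyRegular (AmplyRegular.hammingGraph p 3) (3 ^ p) (2 * p) 1 2 := by
      simpa [mul_comm] using AmplyRegular.isAmplyRegular_hammingGraph p 3
    have h2 : 2 ≤ 3 ^ p := le_trans (by norm_num) (Nat.le_self_pow (by omega : p ≠ 0) 3)
    refine ⟨hconn, hG, le_antisymm ?_ ?_⟩
    · exact AmplyRegular.adjEigenvalue_second_le hG.card h2 fun f σ hf ⟨_, _, h⟩ =>
        hG.eigenvalue_le_sub_three hconn (by norm_num) le_rfl hf h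
    · simpa [mul_comm] using
        AmplyRegular.le_adjEigenvalue_second_hammingGraph hp (by norm_num) hG.card h2
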